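/- For $i=1,2$ let $G_i$ be a countable abelian group, $(X_i,\mu_i)$ a Lebesgue (standard) probability space and $g\mapsto T^{(i)}_g\in\mathrm{Aut}(X_i,\mu_i)$ a free measure-preserving action of $G_i$, i.e. a homomorphism into the group of measure-preserving transformations modulo null sets such that for every $g\ne 0$ one has $T^{(i)}_gx\neq x$ for almost every $x$. Let $R_{T^{(i)}}=L^\infty(X_i,\mu_i)\rtimes G_i$ be the von Neumann algebra crossed product for the action $\alpha_g(f)=f\circ T^{(i)}_{-g}$, let $C_{T^{(i)}}\subset R_{T^{(i)}}$ be the image of $L^\infty(X_i,\mu_i)$, and let $S_{T^{(i)}}\subset R_{T^{(i)}}$ be the von Neumann subalgebra generated by the canonical unitaries $v_g$, $g\in G_i$, implementing the action. Suppose there is a $*$-isomorphism $\gamma\colon R_{T^{(1)}}\to R_{T^{(2)}}$ with $\gamma(S_{T^{(1)}})=S_{T^{(2)}}$ and $\gamma(C_{T^{(1)}})=C_{T^{(2)}}$. Then there exist a group isomorphism $\beta\colon G_2\to G_1$ and an invertible (modulo null sets) non-singular transformation $S\colon(X_1,\mu_1)\to(X_2,\mu_2)$ such that $$T^{(2)}_g=S\,T^{(1)}_{\beta(g)}\,S^{-1}\quad\text{almost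 everywhere, for every } g\in G_2 .$$ If moreover at least one of the two actions is ergodic, then $S$ is measure-preserving, i.e. an isomorphism of the measure spaces $(X_1,\mu_1)$ and $(X_2,\mu_2)$. -/

import Mathlib

open MeasureTheory
open scoped ENNReal

noncomputable section

namespace CrossedProd

/-- A measure-preserving action of an additive abelian group `G` on `(X, μ)`: a homomorphism from
`G` to the group `Aut(X, μ)` of measure-preserving transformations modulo null sets.
Invertibility of each `T g` modulo null sets follows from `map_zero` and `map_add`. -/
structure MPAction (G : Type*) [AddCommGroup G] {X : Type*} [MeasurableSpace X]
    (μ : Measure X) where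
  /-- The transformation `T_g`. -/
  toFun : G → X → X
  measurePreserving : ∀ g, MeasurePreserving (toFun g) μ μ
  map_zero : toFun 0 =ᵐ[μ] id
  map_add : ∀ g h, toFun (g + h) =ᵐ[μ] toFun g ∘ toFun h

instance {G : Type*} [AddCommGroup G] {X : Type*} [MeasurableSpace X] {μ : Measure X} :
    CoeFun (MPAction G μ) (fun _ => G → X → X) := ⟨MPAction.toFun⟩

/-- An isomorphism of measure spaces modulo null sets in the category of measure classes:
an invertible non-singular transformation. -/
structure NonsingularIso {X Y : Type*} [MeasurableSpace X] [MeasurableSpace Y]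
    (μ : Measure X) (ν : Measure Y) where
  toFun : X → Y
  invFun : Y → X
  quasiMeasurePreserving : Measure.QuasiMeasurePreserving toFun μ ν
  quasiMeasurePreserving_inv : Measure.QuasiMeasurePreserving invFun ν μ
  left_inv : invFun ∘ toFun =ᵐ[μ] id
  right_inv : toFun ∘ invFun =ᵐ[ν] id

section Hilbert

variable {H : Type*} [NormedAddCommGroup H] [InnerProductSpace ℂ H] [CompleteSpace H]

/-- The von Neumann algebra generated by a set `s` of bounded operators: the double commutant of
`s ∪ s*`. -/
def vonNeumannClosure (s : Set (H →L[ℂ] H)) : VonNeumannAlgebra H where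
  toStarSubalgebra :=
    StarSubalgebra.centralizer ℂ (StarSubalgebra.centralizer ℂ s : Set (H →L[ℂ] H))
  centralizer_centralizer' := by
    change Set.centralizer (Set.centralizer
      (StarSubalgebra.centralizer ℂ (StarSubalgebra.centralizer ℂ s : Set (H →L[ℂ] H)) :
        Set (H →L[ℂ] H))) =
      (StarSubalgebra.centralizer ℂ (StarSubalgebra.centralizer ℂ s : Set (H →L[ℂ] H)) :
        Set (H →L[ℂ] H))
    rw [StarSubalgebra.coe_centralizer_centralizer]
    exact Set.centralizer_centralizer_centralizer (s ∪ star s).centralizer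

end Hilbert

section SequenceSpace

variable {ι κ : Type*} {E : Type*} [NormedAddCommGroup E] [InnerProductSpace ℂ E]

/-- `ℓ²(ι, E)`, the Hilbert space of square-summable `E`-valued families. -/
abbrev L2Seq (ι : Type*) (E : Type*) [NormedAddCommGroup E] : Type _ :=
  lp (fun _ : ι => E) 2

theorem memlp_diag (A : ι → E →L[ℂ] E) (C : ℝ) (hA : ∀ i, ‖A i‖ ≤ C) (ξ : L2Seq ι E) :
    Memℓp (fun i => A i (ξ i)) 2 := by
  have h := (lp.memℓp ξ).summable (p := 2) (by norm_num)
  refine memℓp_gen (Summable.of_nonneg_of_le (fun i => by positivity) (fun i => ?_)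
    (h.mul_left (C ^ (2 : ENNReal).toReal)))
  have hC : 0 ≤ C := (norm_nonneg _).trans (hA i)
  rw [← Real.mul_rpow hC (norm_nonneg _)]
  exact Real.rpow_le_rpow (norm_nonneg _) ((A i).le_of_opNorm_le (hA i) _) (by norm_num)

/-- The diagonal operator `(ξ_i)_i ↦ (A_i ξ_i)_i` on `ℓ²(ι, E)` of a bounded family `A`. -/
def diagL (A : ι → E →L[ℂ] E) (C : ℝ) (hC : 0 ≤ C) (hA : ∀ i, ‖A i‖ ≤ C) :
    L2Seq ι E →L[ℂ] L2Seq ι E :=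
  LinearMap.mkContinuous
    { toFun := fun ξ => ⟨fun i => A i (ξ i), memlp_diag A C hA ξ⟩
      map_add' := fun ξ η => by ext1; funext i; exact (A i).map_add _ _
      map_smul' := fun c ξ => by ext1; funext i; exact (A i).map_smul _ _ } C
    (fun ξ => by
      have h2 : (0 : ℝ) < (2 : ENNReal).toReal := by norm_num
      refine lp.norm_le_of_forall_sum_le h2 (by positivity) (fun s => ?_)
      rw [Real.mul_rpow hC (norm_nonneg _)]
      refine le_trans ?_ (mul_le_mul_of_nonneg_left (lp.sum_rpow_le_norm_rpow h2 ξ s)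
        (by positivity))
      rw [Finset.mul_sum]
      refine Finset.sum_le_sum (fun i _ => ?_)
      rw [← Real.mul_rpow hC (norm_nonneg _)]
      exact Real.rpow_le_rpow (norm_nonneg _) ((A i).le_of_opNorm_le (hA i) _) h2.le)

theorem memlp_reindex {E : Type*} [NormedAddCommGroup E] (e : ι ≃ κ) (ξ : L2Seq κ E) :
    Memℓp (fun i => ξ (e i)) 2 :=
  memℓp_gen ((e.summable_iff (f := fun k => ‖ξ k‖ ^ (2 : ENNReal).toReal)).2
    ((lp.memℓp ξ).summable (by norm_num)))

/-- The unitary operator `(ξ_k)_k ↦ (ξ_{e i})_i` given by a bijection `e` of index sets. -/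
def reindexL (e : ι ≃ κ) : L2Seq κ E →L[ℂ] L2Seq ι E :=
  LinearMap.mkContinuous
    { toFun := fun ξ => ⟨fun i => ξ (e i), memlp_reindex e ξ⟩
      map_add' := fun ξ η => rfl
      map_smul' := fun c ξ => rfl } 1
    (fun ξ => by
      have h2 : (0 : ℝ) < (2 : ENNReal).toReal := by norm_num
      refine lp.norm_le_of_tsum_le h2 (by positivity) ?_
      rw [one_mul, lp.norm_rpow_eq_tsum h2]
      exact (e.tsum_eq (fun k => ‖ξ k‖ ^ (2 : ENNReal).toReal)).le)

end SequenceSpace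

/-- The operator on `L²(X, μ)` of multiplication by `f ∈ L^∞(X, μ)`. -/
def mulOp {X : Type*} [MeasurableSpace X] {μ : Measure X} (f : Lp ℂ ∞ μ) :
    Lp ℂ 2 μ →L[ℂ] Lp ℂ 2 μ :=
  (ContinuousLinearMap.mul ℂ ℂ).holderL μ ∞ 2 2 f

theorem norm_mulOp_le {X : Type*} [MeasurableSpace X] {μ : Measure X} (f : Lp ℂ ∞ μ) :
    ‖mulOp f‖ ≤ ‖f‖ := by
  refine ContinuousLinearMap.opNorm_le_bound _ (norm_nonneg f) (fun ξ => ?_)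
  refine ((ContinuousLinearMap.mul ℂ ℂ).norm_holder_apply_apply_le f ξ).trans ?_
  simp

namespace MPAction

variable {G : Type*} [AddCommGroup G] {X : Type*} [MeasurableSpace X] {μ : Measure X}
  (T : MPAction G μ)

/-- The action is free: every `g ≠ 0` moves almost every point. -/
def IsFree : Prop := ∀ g : G, g ≠ 0 → ∀ᵐ x ∂μ, T g x ≠ x

/-- The action is ergodic: every invariant measurable set is null or conull. -/
def IsErgodic : Prop :=
  ∀ s : Set X, MeasurableSet s → (∀ g, T g ⁻¹' s =ᵐ[μ] s) → μ s = 0 ∨ μ sᶜ = 0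

/-- The Hilbert space `ℓ²(G, L²(X, μ)) = L²(X, μ) ⊗ ℓ²(G)` on which the crossed product acts. -/
abbrev Space (_ : MPAction G μ) : Type _ := L2Seq G (Lp ℂ 2 μ)

/-- The automorphism `α_g(f) = f ∘ T_{-g}` of `L^∞(X, μ)`. -/
def alpha (g : G) (f : Lp ℂ ∞ μ) : Lp ℂ ∞ μ :=
  Lp.compMeasurePreserving (T (-g)) (T.measurePreserving (-g)) f

/-- The copy in the crossed product of a function `f ∈ L^∞(X, μ)`:
`(π(f) ξ)_h = α_{-h}(f) ξ_h`. -/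
def funOp (f : Lp ℂ ∞ μ) : T.Space →L[ℂ] T.Space :=
  diagL (fun h : G => mulOp (T.alpha (-h) f)) ‖f‖ (norm_nonneg f) (fun h =>
    (norm_mulOp_le _).trans (Lp.norm_compMeasurePreserving f (T.measurePreserving (-(-h)))).le)

/-- The canonical unitary `v_g` in the crossed product: `(v_g ξ)_h = ξ_{h - g}`. -/
def groupOp (g : G) : T.Space →L[ℂ] T.Space := reindexL (Equiv.subRight g)

/-- The crossed product `R_T = L^∞(X, μ) ⋊ G`. -/
def crossedProduct : VonNeumannAlgebra T.Space :=
  vonNeumannClosure (Set.range T.funOp ∪ Set.range T.groupOp)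

/-- The crossed product as a type, with its `*`-algebra structure. -/
abbrev R : Type _ := T.crossedProduct.toStarSubalgebra

/-- The subalgebra `C_T` of `R_T`, the image of `L^∞(X, μ)`. -/
def C : Set T.R := {a | (a : T.Space →L[ℂ] T.Space) ∈ Set.range T.funOp}

/-- The subalgebra `S_T` of `R_T`, the von Neumann algebra generated by the unitaries `v_g`. -/
def S : Set T.R :=
  {a | (a : T.Space →L[ℂ] T.Space) ∈ vonNeumannClosure (Set.range T.groupOp)}

end MPAction

end CrossedProd

end

noncomputable section

/-! Projections in `C_T` are the indicators `1_A`, and `A ≤ B` modulo null sets says `1_A 1_B =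
1_A`. Hence `γ` induces an isomorphism of measure algebras, which on standard Borel spaces comes
from a non-singular point isomorphism `S` (`exists_nonsingularIso`).

To compare the actions, put `u = γ⁻¹(v_k)`. Since `u` lies in the von Neumann algebra of the group,
it commutes with all operators acting as one fixed operator in every coordinate, so its matrix
coefficients are scalars; since it is invertible, some coefficient `c` at `h` is nonzero. Covariance
of `v_k` pulls back to `u 1_A = 1_{A'} u`, and reading coordinate `h` of this identity gives `A =
T_h⁻¹ A'`. Thus each `T₂ g` is intertwined by `S` with some `T₁ h` (`exists_intertwines`). Freeness
makes `h` unique, so `g ↦ h` is a homomorphism, and the same argument for `γ⁻¹` makes it bijective.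

In the ergodic case the image measure under `S` or `S⁻¹` is an absolutely continuous invariant
probability measure, hence the given one. -/

namespace CrossedProd

/-! ### Point realization of isomorphisms of measure algebras. -/

section PointRealization

variable {X Y : Type*} [MeasurableSpace X] [MeasurableSpace Y] {μ : Measure X} {ν : Measure Y}

theorem ae_eq_of_forall_preimage_ae_eq [StandardBorelSpace Y] {f g : X → Y}
    (h : ∀ B, MeasurableSet B → f ⁻¹' B =ᵐ[μ] g ⁻¹' B) : f =ᵐ[μ] g :=
  Filter.EventuallyEq.of_forall_separating_preimage MeasurableSet h

/-- A correspondence between the measurable sets of `X` and those of `Y` which induces an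
isomorphism of the measure algebras. -/
structure MeasureAlgebraRel (μ : Measure X) (ν : Measure Y) where
  rel : Set X → Set Y → Prop
  measurable_left : ∀ {A B}, rel A B → MeasurableSet A
  measurable_right : ∀ {A B}, rel A B → MeasurableSet B
  exists_right : ∀ A, MeasurableSet A → ∃ B, rel A B
  exists_left : ∀ B, MeasurableSet B → ∃ A, rel A B
  ae_le_iff : ∀ {A B A' B'}, rel A B → rel A' B' → (A ≤ᵐ[μ] A' ↔ B ≤ᵐ[ν] B')
  compl : ∀ {A B}, rel A B → rel Aᶜ Bᶜ

namespace MeasureAlgebraRel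

variable (r : MeasureAlgebraRel μ ν)

/-- The inverse correspondence. -/
def symm : MeasureAlgebraRel ν μ where
  rel B A := r.rel A B
  measurable_left := r.measurable_right
  measurable_right := r.measurable_left
  exists_right := r.exists_left
  exists_left := r.exists_right
  ae_le_iff h h' := (r.ae_le_iff h h').symm
  compl := r.compl

variable {r}

theorem ae_eq_iff {A B A' B'} (h : r.rel A B) (h' : r.rel A' B') :
    A =ᵐ[μ] A' ↔ B =ᵐ[ν] B' := by
  exact ⟨fun e => ((r.ae_le_iff h h').1 e.le).antisymm ((r.ae_le_iff h' h).1 e.symm.le),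
    fun e => ((r.ae_le_iff h h').2 e.le).antisymm ((r.ae_le_iff h' h).2 e.symm.le)⟩

/-- An order isomorphism preserves countable suprema, and a countable union is a supremum modulo
null sets. -/
theorem iUnion_ae_eq {A : ℕ → Set X} {B : ℕ → Set Y} (h : ∀ n, r.rel (A n) (B n))
    {A' : Set X} (h' : r.rel A' (⋃ n, B n)) : A' =ᵐ[μ] ⋃ n, A n := by
  obtain ⟨D, hD⟩ := r.exists_right (⋃ n, A n)
    (MeasurableSet.iUnion fun n => r.measurable_left (h n))
  refine Filter.EventuallyLE.antisymm ((r.ae_le_iff h' hD).2 ?_) ?_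
  · have h1 : ∀ n, B n ≤ᵐ[ν] D := fun n =>
      (r.ae_le_iff (h n) hD).1 (Set.subset_iUnion A n).eventuallyLE
    filter_upwards [ae_all_iff.2 h1] with y hy hyB
    obtain ⟨n, hn⟩ := Set.mem_iUnion.1 hyB
    exact hy n hn
  · have h1 : ∀ n, A n ≤ᵐ[μ] A' := fun n =>
      (r.ae_le_iff (h n) h').2 (Set.subset_iUnion B n).eventuallyLE
    filter_upwards [ae_all_iff.2 h1] with x hx hxA
    obtain ⟨n, hn⟩ := Set.mem_iUnion.1 hxA
    exact hx n hn

/-- An isomorphism of the measure algebras is implemented by a point map. -/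
theorem exists_point_map (r : MeasureAlgebraRel μ ν) [StandardBorelSpace Y] [Nonempty Y] :
    ∃ f : X → Y, Measurable f ∧ ∀ A B, r.rel A B → f ⁻¹' B =ᵐ[μ] A := by
  classical
  -- Code `Y` in Cantor space by `m`, and code `X` by `s` through sets `A n` corresponding to the
  -- coordinate sets of `m`. As `s` may leave the range of `m`, decode with a globally defined
  -- measurable left inverse `i`.
  let m : Y → ℕ → Bool := MeasurableSpace.mapNatBool Y
  have hm : Measurable m := MeasurableSpace.measurable_mapNatBool Y
  have hme : MeasurableEmbedding m :=
    hm.measurableEmbedding (MeasurableSpace.injective_mapNatBool Y)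
  have hgen (n : ℕ) : MeasurableSet {y | m y n = true} :=
    measurableSet_eq_fun (measurable_pi_apply n |>.comp hm) measurable_const
  choose A hA using fun n => r.exists_left _ (hgen n)
  let s : X → ℕ → Bool := fun x n => decide (x ∈ A n)
  have hpre (n : ℕ) : (fun x => s x n) ⁻¹' {true} = A n := by ext x; simp [s]
  have hs : Measurable s := measurable_pi_iff.2 fun n =>
    measurable_to_bool (by rw [hpre]; exact r.measurable_left (hA n))
  have hev (n : ℕ) : MeasurableSet ((fun a : ℕ → Bool => a n) ⁻¹' {true}) :=
    measurable_pi_apply n (MeasurableSet.of_discrete)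
  obtain ⟨i, hi, him⟩ : ∃ i : (ℕ → Bool) → Y, Measurable i ∧ i ∘ m = id :=
    ⟨hme.invFun, hme.measurable_invFun, hme.leftInverse_invFun.comp_eq_id⟩
  have his : Measurable (i ∘ s) := hi.comp hs
  have hpreim (B : Set Y) (hB : MeasurableSet B) : MeasurableSet (i ⁻¹' B) := hi hB
  -- The Borel sets of Cantor space on which `s` realizes the correspondence form a σ-algebra; it
  -- contains the coordinate sets, hence every Borel set.
  let good : MeasurableSpace (ℕ → Bool) :=
    { MeasurableSet' := fun D => MeasurableSet D ∧ ∀ A, r.rel A (m ⁻¹' D) → s ⁻¹' D =ᵐ[μ] A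
      measurableSet_empty := by
        refine ⟨MeasurableSet.empty, fun A' h' => ?_⟩
        obtain ⟨D, hD⟩ := r.exists_right ∅ MeasurableSet.empty
        exact (Filter.EventuallyLE.antisymm (Set.empty_subset _).eventuallyLE
          ((r.ae_le_iff h' hD).2 (Set.empty_subset _).eventuallyLE))
      measurableSet_compl := by
        rintro D ⟨hD, h⟩
        refine ⟨hD.compl, fun A' h' => ?_⟩
        have h2 := h _ (by simpa using r.compl h')
        simpa using h2.compl
      measurableSet_iUnion := by
        intro D hD
        refine ⟨MeasurableSet.iUnion fun n => (hD n).1, fun A' h' => ?_⟩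
        choose A'' hA'' using fun n => r.exists_left _ (hm (hD n).1)
        rw [Set.preimage_iUnion] at h' ⊢
        exact (Filter.EventuallyEq.countable_iUnion fun n => (hD n).2 _ (hA'' n)).trans
          (iUnion_ae_eq hA'' h').symm }
  have hle : MeasurableSpace.pi ≤ good := by
    refine iSup_le fun n => MeasurableSpace.comap_le_iff_le_map.2 ?_
    refine @measurable_to_bool _ good (fun a : ℕ → Bool => a n) ⟨hev n, fun A' h' => ?_⟩
    rw [show s ⁻¹' ((fun a : ℕ → Bool => a n) ⁻¹' {true}) = A n from hpre n]
    exact (ae_eq_iff (hA n) h').2 Filter.EventuallyEq.rfl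
  refine ⟨i ∘ s, his, fun A' B' h' => ?_⟩
  have hB := hpreim _ (r.measurable_right h')
  refine (hle _ hB).2 _ ?_
  rwa [← Set.preimage_comp, him]

theorem quasiMeasurePreserving {f : X → Y} (hf : Measurable f)
    (h : ∀ A B, r.rel A B → f ⁻¹' B =ᵐ[μ] A) : Measure.QuasiMeasurePreserving f μ ν := by
  refine ⟨hf, Measure.AbsolutelyContinuous.mk fun B hB h0 => ?_⟩
  obtain ⟨A, hA⟩ := r.exists_left B hB
  -- A null `B` lies almost everywhere below any `D`, so its partner `A` lies below `∅`.
  obtain ⟨D, hD⟩ := r.exists_right ∅ MeasurableSet.empty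
  rw [Measure.map_apply hf hB, measure_congr (h A B hA), ← nonpos_iff_eq_zero,
    ← measure_empty (μ := μ)]
  refine measure_mono_ae ((r.ae_le_iff hA hD).2 ?_)
  exact (ae_eq_empty.2 h0).le.trans (Set.empty_subset _).eventuallyLE

theorem comp_ae_eq_id [StandardBorelSpace X] {f : X → Y} {g : Y → X}
    (hf : Measure.QuasiMeasurePreserving f μ ν)
    (hfr : ∀ A B, r.rel A B → f ⁻¹' B =ᵐ[μ] A) (hgr : ∀ A B, r.rel A B → g ⁻¹' A =ᵐ[ν] B) :
    g ∘ f =ᵐ[μ] id := by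
  refine ae_eq_of_forall_preimage_ae_eq fun A hA => ?_
  obtain ⟨B, hB⟩ := r.exists_right A hA
  rw [Set.preimage_comp, Set.preimage_id]
  exact (hf.preimage_ae_eq (hgr A B hB)).trans (hfr A B hB)

end MeasureAlgebraRel

end PointRealization

namespace NonsingularIso

variable {X Y : Type*} [MeasurableSpace X] [MeasurableSpace Y] {μ : Measure X} {ν : Measure Y}

/-- The inverse transformation. -/
def symm (S : NonsingularIso μ ν) : NonsingularIso ν μ where
  toFun := S.invFun
  invFun := S.toFun
  quasiMeasurePreserving := S.quasiMeasurePreserving_inv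
  quasiMeasurePreserving_inv := S.quasiMeasurePreserving
  left_inv := S.right_inv
  right_inv := S.left_inv

end NonsingularIso

/-- An isomorphism of the measure algebras of standard Borel spaces is implemented by an invertible
non-singular transformation. -/
theorem MeasureAlgebraRel.exists_nonsingularIso {X Y : Type*} [MeasurableSpace X]
    [MeasurableSpace Y] [StandardBorelSpace X] [StandardBorelSpace Y] [Nonempty X] [Nonempty Y]
    {μ : Measure X} {ν : Measure Y} (r : MeasureAlgebraRel μ ν) :
    ∃ S : NonsingularIso μ ν, (∀ A B, r.rel A B → S.toFun ⁻¹' B =ᵐ[μ] A) ∧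
      ∀ A B, r.rel A B → S.invFun ⁻¹' A =ᵐ[ν] B := by
  obtain ⟨f, hf, hfr⟩ := r.exists_point_map
  obtain ⟨g, hg, hgr⟩ := r.symm.exists_point_map
  have hgr' : ∀ A B, r.rel A B → g ⁻¹' A =ᵐ[ν] B := fun A B h => hgr B A h
  have hfq := quasiMeasurePreserving hf hfr
  have hgq := quasiMeasurePreserving (r := r.symm) hg hgr
  exact ⟨⟨f, g, hfq, hgq, comp_ae_eq_id hfq hfr hgr',
    comp_ae_eq_id (r := r.symm) hgq hgr (fun A B h => hfr B A h)⟩, hfr, hgr'⟩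

/-! ### Consequences of freeness and ergodicity. -/

namespace MPAction

variable {G X : Type*} [AddCommGroup G] [MeasurableSpace X] {μ : Measure X} {T : MPAction G μ}

theorem quasiMeasurePreserving (T : MPAction G μ) (g : G) :
    Measure.QuasiMeasurePreserving (T g) μ μ :=
  (T.measurePreserving g).quasiMeasurePreserving

/-- For a free action, group elements acting by the same transformation agree. -/
theorem IsFree.eq_of_ae_eq [NeZero μ] (hT : T.IsFree) {g h : G} (hgh : T g =ᵐ[μ] T h) :
    g = h := by
  by_contra hne
  have h1 : T (g - h) =ᵐ[μ] id := by
    have h2 : T (g - h) =ᵐ[μ] T g ∘ T (-h) := by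
      rw [sub_eq_add_neg]; exact T.map_add g (-h)
    have h3 : T h ∘ T (-h) =ᵐ[μ] id := by
      have := T.map_add h (-h)
      rw [add_neg_cancel] at this
      exact this.symm.trans T.map_zero
    exact h2.trans (((T.quasiMeasurePreserving (-h)).ae_eq_comp hgh).trans h3)
  have h4 := hT (g - h) (sub_ne_zero.2 hne)
  obtain ⟨x, hx, hx'⟩ := (h1.and h4).exists
  exact hx' hx

/-- An ergodic action has only one absolutely continuous invariant probability measure. -/
theorem IsErgodic.eq_of_absolutelyContinuous [IsProbabilityMeasure μ] (hT : T.IsErgodic)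
    {ν : Measure X} [IsProbabilityMeasure ν] (hν : ν ≪ μ)
    (hTν : ∀ g, MeasurePreserving (T g) ν ν) : ν = μ := by
  -- The density is invariant because `T g` preserves both measures. If this set is null then `ν ≤
  -- μ`, if conull then `μ ≤ ν`; comparable probability measures are equal.
  have hmeas : MeasurableSet {x | 1 < ν.rnDeriv μ x} :=
    measurableSet_lt measurable_const (Measure.measurable_rnDeriv ν μ)
  have hd := Measure.withDensity_rnDeriv_eq ν μ hν
  rcases hT {x | 1 < ν.rnDeriv μ x} hmeas fun g => by
    filter_upwards [(hTν g).rnDeriv_comp_aeEq (T.measurePreserving g)] with x hx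
    have hx' : ν.rnDeriv μ (T g x) = ν.rnDeriv μ x := hx
    change (1 < ν.rnDeriv μ (T g x)) = (1 < ν.rnDeriv μ x)
    rw [hx'] with h | h
  · refine Measure.eq_of_le_of_isProbabilityMeasure ?_
    rw [← hd]
    conv_rhs => rw [← withDensity_one (μ := μ)]
    refine withDensity_mono ?_
    filter_upwards [measure_eq_zero_iff_ae_notMem.1 h] with x hx using not_lt.1 hx
  · refine (Measure.eq_of_le_of_isProbabilityMeasure ?_).symm
    rw [← hd]
    conv_lhs => rw [← withDensity_one (μ := μ)]
    refine withDensity_mono ?_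
    filter_upwards [measure_eq_zero_iff_ae_notMem.1 h] with x hx
    simp only [Set.mem_compl_iff, Set.mem_ofPred_eq, not_not] at hx
    exact hx.le

end MPAction

/-! ### From intertwining relations to a group isomorphism. -/

section Conjugacy

variable {G₁ G₂ X₁ X₂ : Type*} [AddCommGroup G₁] [AddCommGroup G₂]
  [MeasurableSpace X₁] [MeasurableSpace X₂] {μ₁ : Measure X₁} {μ₂ : Measure X₂}
  {T₁ : MPAction G₁ μ₁} {T₂ : MPAction G₂ μ₂}

/-- Intertwining relations pass to the inverse transformation. -/
theorem NonsingularIso.symm_intertwines (S : NonsingularIso μ₁ μ₂) {h : G₁} {g : G₂}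
    (H : T₂ g ∘ S.toFun =ᵐ[μ₁] S.toFun ∘ T₁ h) :
    T₁ h ∘ S.invFun =ᵐ[μ₂] S.invFun ∘ T₂ g := by
  have h1 := S.quasiMeasurePreserving_inv.ae_eq_comp H
  have h2 := (S.quasiMeasurePreserving_inv.tendsto_ae).eventually
    ((T₁.quasiMeasurePreserving h).tendsto_ae.eventually S.left_inv)
  filter_upwards [h1, h2, S.right_inv] with y hy1 hy2 hy3
  simp only [Function.comp_apply, id] at *
  rw [hy3] at hy1
  rw [hy1, hy2]

theorem NonsingularIso.eq_conj (S : NonsingularIso μ₁ μ₂) {h : G₁} {g : G₂}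
    (H : T₂ g ∘ S.toFun =ᵐ[μ₁] S.toFun ∘ T₁ h) :
    T₂ g =ᵐ[μ₂] S.toFun ∘ T₁ h ∘ S.invFun := by
  filter_upwards [S.quasiMeasurePreserving_inv.ae_eq_comp H, S.right_inv] with y hy1 hy3
  simp only [Function.comp_apply, id] at *
  rw [hy3] at hy1
  exact hy1

/-- A non-singular transformation intertwining an action with an ergodic one preserves the
measure. -/
theorem NonsingularIso.measurePreserving_of_isErgodic [IsProbabilityMeasure μ₁]
    [IsProbabilityMeasure μ₂] (S : NonsingularIso μ₁ μ₂)
    (H : ∀ g, ∃ h, T₂ g ∘ S.toFun =ᵐ[μ₁] S.toFun ∘ T₁ h) (hT₂ : T₂.IsErgodic) :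
    MeasurePreserving S.toFun μ₁ μ₂ := by
  have hm := S.quasiMeasurePreserving.measurable
  have := Measure.isProbabilityMeasure_map (μ := μ₁) hm.aemeasurable
  refine ⟨hm, hT₂.eq_of_absolutelyContinuous S.quasiMeasurePreserving.absolutelyContinuous
    fun g => ?_⟩
  obtain ⟨h, hh⟩ := H g
  refine ⟨(T₂.measurePreserving g).measurable, ?_⟩
  rw [Measure.map_map (T₂.measurePreserving g).measurable hm, Measure.map_congr hh,
    ← Measure.map_map hm (T₁.measurePreserving h).measurable, (T₁.measurePreserving h).map_eq]

/-- Cancelling `S` gives `T₁ h = T₁ h'` almost everywhere, and freeness separates group elements.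
This makes the choice of `h` canonical, hence additive in `g`. -/
theorem NonsingularIso.intertwines_unique_left [NeZero μ₁] (S : NonsingularIso μ₁ μ₂)
    (hT₁ : T₁.IsFree) {h h' : G₁} {g : G₂}
    (H : T₂ g ∘ S.toFun =ᵐ[μ₁] S.toFun ∘ T₁ h) (H' : T₂ g ∘ S.toFun =ᵐ[μ₁] S.toFun ∘ T₁ h') :
    h = h' := by
  refine hT₁.eq_of_ae_eq ?_
  filter_upwards [H.symm.trans H', (T₁.quasiMeasurePreserving h).tendsto_ae.eventually S.left_inv,
    (T₁.quasiMeasurePreserving h').tendsto_ae.eventually S.left_inv] with x hx h1 h2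
  simp only [Function.comp_apply, id] at *
  rw [← h1, ← h2, hx]

/-- If a non-singular transformation intertwines every element of either of two free actions with
some element of the other one, then it conjugates the actions up to a group isomorphism. -/
theorem exists_addEquiv_of_intertwines [NeZero μ₁] [NeZero μ₂] (hT₁ : T₁.IsFree) (hT₂ : T₂.IsFree)
    (S : NonsingularIso μ₁ μ₂)
    (H : ∀ g, ∃ h, T₂ g ∘ S.toFun =ᵐ[μ₁] S.toFun ∘ T₁ h)
    (H' : ∀ h, ∃ g, T₂ g ∘ S.toFun =ᵐ[μ₁] S.toFun ∘ T₁ h) :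
    ∃ β : G₂ ≃+ G₁, ∀ g, T₂ g ∘ S.toFun =ᵐ[μ₁] S.toFun ∘ T₁ (β g) := by
  choose β hβ using H
  have hadd (g g' : G₂) : β (g + g') = β g + β g' := by
    refine S.intertwines_unique_left hT₁ (hβ (g + g')) ?_
    filter_upwards [S.quasiMeasurePreserving.tendsto_ae.eventually (T₂.map_add g g'),
      T₁.map_add (β g) (β g'), hβ g',
      (T₁.quasiMeasurePreserving (β g')).tendsto_ae.eventually (hβ g)] with x h1 h2 h3 h4
    simp only [Function.comp_apply] at *
    rw [h1, h2, h3, h4]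
  have hbij : Function.Bijective β := by
    refine ⟨fun g g' hgg => ?_, fun h => ?_⟩
    · refine S.symm.intertwines_unique_left hT₂ (S.symm_intertwines (hβ g)) ?_
      rw [hgg]
      exact S.symm_intertwines (hβ g')
    · obtain ⟨g, hg⟩ := H' h
      exact ⟨g, S.intertwines_unique_left hT₁ (hβ g) hg⟩
  exact ⟨AddEquiv.ofBijective (AddMonoidHom.mk' β hadd) hbij, hβ⟩

end Conjugacy


/-! ### Commutants and matrix coefficients on `ℓ²(ι, E)`. -/

section Hilbert

variable {H : Type*} [NormedAddCommGroup H] [InnerProductSpace ℂ H]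

theorem mul_op_apply (a b : H →L[ℂ] H) (x : H) : (a * b) x = a (b x) := rfl

variable [CompleteSpace H]

theorem mem_vonNeumannClosure_iff {s : Set (H →L[ℂ] H)} {x : H →L[ℂ] H} :
    x ∈ vonNeumannClosure s ↔
      x ∈ StarSubalgebra.centralizer ℂ (StarSubalgebra.centralizer ℂ s : Set (H →L[ℂ] H)) :=
  Iff.rfl

theorem subset_vonNeumannClosure {s : Set (H →L[ℂ] H)} {x : H →L[ℂ] H} (hx : x ∈ s) :
    x ∈ vonNeumannClosure s := by
  rw [mem_vonNeumannClosure_iff, StarSubalgebra.mem_centralizer_iff]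
  intro b hb
  have hb' := StarSubalgebra.mem_centralizer_iff ℂ |>.1 hb x hx
  refine ⟨hb'.1.symm, ?_⟩
  have := congrArg star hb'.2
  simpa using this

/-- The von Neumann algebra generated by a self-adjoint set commutes with its commutant. -/
theorem commute_of_mem_vonNeumannClosure {s : Set (H →L[ℂ] H)} (hs : ∀ x ∈ s, star x ∈ s)
    {u b : H →L[ℂ] H} (hu : u ∈ vonNeumannClosure s) (hb : ∀ x ∈ s, x * b = b * x) :
    b * u = u * b := by
  rw [mem_vonNeumannClosure_iff, StarSubalgebra.mem_centralizer_iff] at hu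
  exact (hu b ((StarSubalgebra.mem_centralizer_iff ℂ).2
    fun x hx => ⟨hb x hx, hb _ (hs x hx)⟩)).1

end Hilbert

section SequenceSpace

variable {ι κ : Type*} {E : Type*} [NormedAddCommGroup E] [InnerProductSpace ℂ E]

theorem diagL_apply (A : ι → E →L[ℂ] E) (C : ℝ) (hC : 0 ≤ C) (hA : ∀ i, ‖A i‖ ≤ C)
    (ξ : L2Seq ι E) (i : ι) : diagL A C hC hA ξ i = A i (ξ i) := rfl

theorem reindexL_apply (e : ι ≃ κ) (ξ : L2Seq κ E) (i : ι) :
    (reindexL e ξ : L2Seq ι E) i = ξ (e i) := rfl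

theorem diagL_single [DecidableEq ι] (A : ι → E →L[ℂ] E) (C : ℝ) (hC : 0 ≤ C)
    (hA : ∀ i, ‖A i‖ ≤ C) (i : ι) (x : E) :
    diagL A C hC hA (lp.single 2 i x) = lp.single 2 i (A i x) := by
  ext1
  funext j
  rw [diagL_apply]
  by_cases h : j = i
  · subst h; simp
  · rw [lp.single_apply_ne _ _ _ h, lp.single_apply_ne _ _ _ h, map_zero]

/-- Places the constant diagonal operators in the commutant of the canonical unitaries. -/
theorem reindexL_mul_diagL_const (e : ι ≃ ι) (A : E →L[ℂ] E) :
    reindexL e * diagL (fun _ : ι => A) ‖A‖ (norm_nonneg A) (fun _ => le_rfl) =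
      diagL (fun _ : ι => A) ‖A‖ (norm_nonneg A) (fun _ => le_rfl) * reindexL e := by
  ext1 ξ; ext1; funext i
  rw [mul_op_apply, mul_op_apply, reindexL_apply, diagL_apply, diagL_apply, reindexL_apply]

/-- The coefficients of an operator on `ℓ²(ι, E)` commuting with all constant diagonal operators
are scalars. -/
theorem exists_coeff_eq_smul_of_commute [DecidableEq ι] {u : L2Seq ι E →L[ℂ] L2Seq ι E}
    (hu : ∀ A : E →L[ℂ] E, diagL (fun _ : ι => A) ‖A‖ (norm_nonneg A) (fun _ => le_rfl) * u =
      u * diagL (fun _ : ι => A) ‖A‖ (norm_nonneg A) (fun _ => le_rfl)) (i j : ι) :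
    ∃ c : ℂ, ∀ x : E, u (lp.single 2 i x) j = c • x := by
  -- `F` is the matrix block of `u` from coordinate `i` to coordinate `j`. It commutes with every
  -- bounded operator on `E`, and the centre of that algebra is the scalars.
  obtain ⟨F, hF⟩ : ∃ F : E →L[ℂ] E, ∀ x, F x = u (lp.single 2 i x) j :=
    ⟨(lp.evalCLM ℂ (fun _ : ι => E) 2 j).comp
      (u.comp (lp.singleContinuousLinearMap ℂ (fun _ : ι => E) 2 i)), fun _ => rfl⟩
  have hc : F ∈ Subalgebra.center ℂ (E →L[ℂ] E) := by
    rw [Subalgebra.mem_center_iff]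
    intro A
    ext1 x
    have := congrArg (fun v : L2Seq ι E →L[ℂ] L2Seq ι E => v (lp.single 2 i x) j) (hu A)
    simp only [mul_op_apply] at this
    rw [diagL_apply, diagL_single] at this
    rw [mul_op_apply, mul_op_apply, hF, hF, this]
  rw [Algebra.IsCentral.center_eq_bot, Algebra.mem_bot] at hc
  obtain ⟨c, hc⟩ := hc
  refine ⟨c, fun x => ?_⟩
  rw [← hF, ← hc, Algebra.algebraMap_eq_smul_one, smul_apply, one_apply_eq_self]

theorem adjoint_reindexL [CompleteSpace E] (e : ι ≃ ι) :
    star (reindexL e : L2Seq ι E →L[ℂ] L2Seq ι E) = reindexL e.symm := by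
  rw [ContinuousLinearMap.star_eq_adjoint]
  symm
  rw [ContinuousLinearMap.eq_adjoint_iff]
  intro ξ η
  rw [lp.inner_eq_tsum, lp.inner_eq_tsum, ← e.tsum_eq]
  exact tsum_congr fun i => by rw [reindexL_apply, reindexL_apply, e.symm_apply_apply]

end SequenceSpace

/-! ### Coefficients and projections in the crossed product. -/

namespace MPAction

variable {G : Type*} [AddCommGroup G] {X : Type*} [MeasurableSpace X] {μ : Measure X}
  (T : MPAction G μ)

theorem coeFn_mulOp (f : Lp ℂ ∞ μ) (x : Lp ℂ 2 μ) : mulOp f x =ᵐ[μ] fun t => f t * x t :=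
  (ContinuousLinearMap.mul ℂ ℂ).coeFn_holder f x

theorem coeFn_funOp (f : Lp ℂ ∞ μ) (ξ : T.Space) (h : G) :
    (T.funOp f ξ) h =ᵐ[μ] fun t => f (T h t) * ξ h t := by
  have h1 : T.alpha (-h) f =ᵐ[μ] f ∘ T (-(-h)) := Lp.coeFn_compMeasurePreserving f _
  rw [neg_neg] at h1
  filter_upwards [coeFn_mulOp (T.alpha (-h) f) (ξ h), h1] with t ht ht1
  rw [funOp, diagL_apply, ht, ht1, Function.comp_apply]

theorem groupOp_apply (g : G) (ξ : T.Space) (h : G) : (T.groupOp g ξ) h = ξ (h - g) := rfl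

theorem star_groupOp (g : G) : star (T.groupOp g) = T.groupOp (-g) := by
  rw [groupOp, adjoint_reindexL]
  ext1 ξ; ext1; funext h
  change ξ (h + g) = ξ (h - -g)
  rw [sub_neg_eq_add]

theorem groupOp_mul_groupOp_neg (g : G) : T.groupOp g * T.groupOp (-g) = 1 := by
  ext1 ξ; ext1; funext h
  change ξ (h - g - -g) = ξ h
  simp

/-- An element of the von Neumann algebra of the group has scalar coefficients. -/
theorem exists_coeff_eq_smul [DecidableEq G] {u : T.Space →L[ℂ] T.Space}
    (hu : u ∈ vonNeumannClosure (Set.range T.groupOp)) (h : G) :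
    ∃ c : ℂ, ∀ x : Lp ℂ 2 μ, u (lp.single 2 0 x) h = c • x := by
  refine exists_coeff_eq_smul_of_commute (fun A => ?_) 0 h
  refine commute_of_mem_vonNeumannClosure ?_ hu ?_
  · rintro _ ⟨g, rfl⟩
    exact ⟨-g, (T.star_groupOp g).symm⟩
  · rintro _ ⟨g, rfl⟩
    exact reindexL_mul_diagL_const _ A

theorem exists_funOp_single [DecidableEq G] (f : Lp ℂ ∞ μ) (x : Lp ℂ 2 μ) :
    ∃ y, T.funOp f (lp.single 2 0 x) = lp.single 2 0 y := by
  rw [funOp, diagL_single]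
  exact ⟨_, rfl⟩

section Finite

variable [IsFiniteMeasure μ]

/-- The indicator function of a measurable set as an element of `L^∞`. -/
def ind (μ : Measure X) [IsFiniteMeasure μ] {A : Set X} (hA : MeasurableSet A) : Lp ℂ ∞ μ :=
  indicatorConstLp ∞ hA (measure_ne_top μ A) 1

theorem coeFn_ind {A : Set X} (hA : MeasurableSet A) :
    ind μ hA =ᵐ[μ] A.indicator fun _ => 1 := indicatorConstLp_coeFn

/-- The projection in the crossed product given by a measurable set. -/
def projOp {A : Set X} (hA : MeasurableSet A) : T.Space →L[ℂ] T.Space := T.funOp (ind μ hA)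

theorem coeFn_projOp {A : Set X} (hA : MeasurableSet A) (ξ : T.Space) (h : G) :
    (T.projOp hA ξ) h =ᵐ[μ] (T h ⁻¹' A).indicator (ξ h) := by
  filter_upwards [T.coeFn_funOp (ind μ hA) ξ h,
    (T.quasiMeasurePreserving h).ae_eq_comp (coeFn_ind hA)] with t ht ht1
  rw [projOp, ht]
  simp only [Function.comp_apply] at ht1
  rw [ht1]
  by_cases hm : T h t ∈ A <;> simp [Set.indicator, hm]

theorem projOp_ext {A : Set X} {hA : MeasurableSet A} {u : T.Space →L[ℂ] T.Space}
    (h : ∀ ξ g, (u ξ) g =ᵐ[μ] (T g ⁻¹' A).indicator (ξ g)) : u = T.projOp hA := by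
  ext1 ξ; ext1; funext g
  exact Lp.ext ((h ξ g).trans (T.coeFn_projOp hA ξ g).symm)

theorem projOp_mul {A B : Set X} (hA : MeasurableSet A) (hB : MeasurableSet B) :
    T.projOp hA * T.projOp hB = T.projOp (hA.inter hB) := by
  refine T.projOp_ext fun ξ g => ?_
  filter_upwards [T.coeFn_projOp hA (T.projOp hB ξ) g, T.coeFn_projOp hB ξ g] with t h1 h2
  rw [mul_op_apply, h1, Set.preimage_inter, ← Set.indicator_indicator]
  by_cases hm : t ∈ T g ⁻¹' A <;> simp only [Set.indicator, hm, if_true, if_false]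
  exact h2

theorem projOp_compl {A : Set X} (hA : MeasurableSet A) :
    1 - T.projOp hA = T.projOp hA.compl := by
  refine T.projOp_ext fun ξ g => ?_
  have h0 : ((1 - T.projOp hA) ξ) g = ξ g - (T.projOp hA ξ) g := rfl
  rw [h0]
  filter_upwards [Lp.coeFn_sub (ξ g) ((T.projOp hA ξ) g), T.coeFn_projOp hA ξ g] with t h1 h2
  rw [h1, Pi.sub_apply, h2, Set.preimage_compl]
  by_cases hm : t ∈ T g ⁻¹' A <;> simp [hm]

/-- The vector `δ₀ ⊗ 1`. -/
def vac [DecidableEq G] : T.Space := lp.single 2 0 (Lp.const 2 μ 1)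

theorem coeFn_vac [DecidableEq G] : (T.vac 0 : X → ℂ) =ᵐ[μ] fun _ => 1 := by
  rw [vac, lp.single_apply_self]
  exact Lp.coeFn_const 2 μ 1

/-- Recovers a function from its operator, so operator identities become almost everywhere
identities. -/
theorem funOp_vac [DecidableEq G] (f : Lp ℂ ∞ μ) : (T.funOp f T.vac) 0 =ᵐ[μ] f := by
  filter_upwards [T.coeFn_funOp f T.vac 0, T.coeFn_vac, T.map_zero] with t h1 h2 h3
  rw [h1, h2, h3, id, mul_one]

theorem projOp_eq_iff {A B : Set X} (hA : MeasurableSet A) (hB : MeasurableSet B) :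
    T.projOp hA = T.projOp hB ↔ A =ᵐ[μ] B := by
  classical
  constructor
  · intro h
    rw [← indicatorConstLp_inj (p := ∞) hA (measure_ne_top μ A) hB (measure_ne_top μ B)
      (one_ne_zero (α := ℂ))]
    have h1 := (T.funOp_vac (ind μ hA)).symm
    rw [show T.funOp (ind μ hA) = T.funOp (ind μ hB) from h] at h1
    exact Lp.ext (h1.trans (T.funOp_vac _))
  · intro h
    refine congrArg T.funOp (Lp.ext ((coeFn_ind hA).trans (.trans ?_ (coeFn_ind hB).symm)))
    exact indicator_ae_eq_of_ae_eq_set h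

/-- Idempotents in the image of `L^∞` are given by measurable sets. -/
theorem exists_eq_projOp {f : Lp ℂ ∞ μ} (hf : T.funOp f * T.funOp f = T.funOp f) :
    ∃ (A : Set X) (hA : MeasurableSet A), T.funOp f = T.projOp hA := by
  classical
  have hA : MeasurableSet {t | f t = 1} :=
    (Lp.stronglyMeasurable f).measurable (measurableSet_singleton 1)
  refine ⟨_, hA, congrArg T.funOp (Lp.ext (.trans ?_ (coeFn_ind hA).symm))⟩
  -- Evaluated at `vac`, idempotence reads `f² = f` almost everywhere, so `f` takes only the values
  -- `0` and `1`.
  have h0 := T.funOp_vac f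
  rw [← hf, mul_op_apply] at h0
  filter_upwards [h0, T.funOp_vac f, T.coeFn_funOp f (T.funOp f T.vac) 0, T.map_zero]
    with t h1 h2 h3 h4
  rw [h3, h2, h4, id] at h1
  by_cases h : f t = 1
  · simp [Set.indicator, h]
  · have : f t = 0 := by
      rcases mul_eq_zero.1 (show f t * (f t - 1) = 0 by rw [mul_sub, h1]; ring) with h' | h'
      · exact h'
      · exact absurd (sub_eq_zero.1 h') h
    simp [Set.indicator, this]

/-- The covariance relation: the shift replaces `h` by `h - g`, and `T_{h-g} = T_{-g} T_h`. -/
theorem groupOp_mul_projOp (g : G) {A : Set X} (hA : MeasurableSet A) :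
    T.groupOp g * T.projOp hA =
      T.projOp ((T.measurePreserving (-g)).measurable hA) * T.groupOp g := by
  ext1 ξ; ext1; funext h
  refine Lp.ext ?_
  simp only [mul_op_apply, groupOp_apply]
  have hadd := T.map_add (-g) h
  rw [neg_add_eq_sub] at hadd
  filter_upwards [T.coeFn_projOp hA ξ (h - g), hadd,
    T.coeFn_projOp ((T.measurePreserving (-g)).measurable hA) (T.groupOp g ξ) h] with t h1 h2 h3
  rw [h1, h3, groupOp_apply]
  have hiff : t ∈ T (h - g) ⁻¹' A ↔ t ∈ T h ⁻¹' (T (-g) ⁻¹' A) := by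
    rw [Set.mem_preimage, h2]; rfl
  by_cases hm : t ∈ T (h - g) ⁻¹' A
  · rw [Set.indicator_of_mem hm, Set.indicator_of_mem (hiff.1 hm)]
  · rw [Set.indicator_of_notMem hm, Set.indicator_of_notMem (mt hiff.2 hm)]

/-- If an operator with a nonzero scalar coefficient at `h` intertwines the projections of two sets,
then these sets correspond to each other under `T_h`. -/
theorem ae_eq_preimage_of_coeff [DecidableEq G] {u : T.Space →L[ℂ] T.Space} {h : G} {c : ℂ}
    (hc : c ≠ 0) (hu : ∀ x : Lp ℂ 2 μ, u (lp.single 2 0 x) h = c • x)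
    {A A' : Set X} (hA : MeasurableSet A) (hA' : MeasurableSet A')
    (hAA : u * T.projOp hA = T.projOp hA' * u) : A =ᵐ[μ] T h ⁻¹' A' := by
  obtain ⟨y, hy⟩ : ∃ y, T.projOp hA T.vac = lp.single 2 0 y :=
    T.exists_funOp_single _ _
  have hy1 : y =ᵐ[μ] A.indicator fun _ => 1 := by
    have h1 := T.funOp_vac (ind μ hA)
    rw [show T.funOp (ind μ hA) T.vac = _ from hy, lp.single_apply_self] at h1
    exact h1.trans (coeFn_ind hA)
  -- At `vac` and coordinate `h` the two sides are `c · 1_A` and `c · 1_{T_h⁻¹A'}`; then `c`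
  -- cancels.
  have h2 := congrArg (fun v : T.Space →L[ℂ] T.Space => v T.vac h) hAA
  simp only [mul_op_apply, hy, hu] at h2
  have h3 := T.coeFn_projOp hA' (u T.vac) h
  rw [← h2] at h3
  rw [vac, hu] at h3
  rw [← indicatorConstLp_inj (p := ∞) hA (measure_ne_top μ A)
    ((T.measurePreserving h).measurable hA') (measure_ne_top μ _) hc]
  refine Lp.ext (indicatorConstLp_coeFn.trans (.trans ?_ indicatorConstLp_coeFn.symm))
  filter_upwards [h3, hy1, Lp.coeFn_smul c y, Lp.coeFn_smul c (Lp.const 2 μ (1 : ℂ)),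
    Lp.coeFn_const 2 μ (1 : ℂ)] with t h3 h4 h5 h6 h7
  rw [h5, Pi.smul_apply, h4] at h3
  simp only [Set.indicator, h6, Pi.smul_apply, h7] at h3 ⊢
  simpa using h3

end Finite

end MPAction


namespace MPAction

variable {G : Type*} [AddCommGroup G] {X : Type*} [MeasurableSpace X] {μ : Measure X}
  (T : MPAction G μ)

/-- The canonical unitary as an element of the crossed product. -/
def groupR (g : G) : T.R :=
  ⟨T.groupOp g, subset_vonNeumannClosure (Or.inr ⟨g, rfl⟩)⟩

theorem groupR_mem_S (g : G) : T.groupR g ∈ T.S :=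
  subset_vonNeumannClosure (s := Set.range T.groupOp) ⟨g, rfl⟩

theorem groupR_neg_mul (g : G) : T.groupR (-g) * T.groupR g = 1 := by
  have h := T.groupOp_mul_groupOp_neg (-g)
  rw [neg_neg] at h
  exact Subtype.ext h

/-- A left-invertible element of the von Neumann algebra of the group has a nonzero scalar
coefficient. -/
theorem exists_coeff_ne_zero [DecidableEq G] [IsFiniteMeasure μ] [NeZero μ] {u v : T.R}
    (hu : u ∈ T.S) (hvu : v * u = 1) :
    ∃ (h : G) (c : ℂ), c ≠ 0 ∧
      ∀ x : Lp ℂ 2 μ, (u : T.Space →L[ℂ] T.Space) (lp.single 2 0 x) h = c • x := by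
  -- If all coefficients vanished, `u` would kill `vac`, and then `vac = v u vac = 0`.
  by_contra hcon
  push Not at hcon
  have h0 : (u : T.Space →L[ℂ] T.Space) T.vac = 0 := by
    ext1; funext h
    obtain ⟨c, hc⟩ := T.exists_coeff_eq_smul hu h
    have hc0 : c = 0 := by
      by_contra hne
      obtain ⟨x, hx⟩ := hcon h c hne
      exact hx (hc x)
    rw [vac, hc, hc0, zero_smul]
    rfl
  have h1 : (v : T.Space →L[ℂ] T.Space) * (u : T.Space →L[ℂ] T.Space) = 1 :=
    congrArg Subtype.val hvu
  have h2 : T.vac = 0 := by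
    have := congrArg (fun w : T.Space →L[ℂ] T.Space => w T.vac) h1
    simp only [mul_op_apply] at this
    rw [h0] at this
    exact this.symm.trans (_root_.map_zero (v : T.Space →L[ℂ] T.Space))
  have h3 := T.coeFn_vac
  rw [h2] at h3
  obtain ⟨x, hx, hx'⟩ := (h3.and (Lp.coeFn_zero ℂ 2 μ)).exists
  exact one_ne_zero (hx.symm.trans hx')

variable [IsFiniteMeasure μ]

/-- The projection of a measurable set as an element of the crossed product. -/
def projR {A : Set X} (hA : MeasurableSet A) : T.R :=
  ⟨T.projOp hA, subset_vonNeumannClosure (Or.inl ⟨_, rfl⟩)⟩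

theorem projR_mem_C {A : Set X} (hA : MeasurableSet A) : T.projR hA ∈ T.C := ⟨_, rfl⟩

theorem projR_mul {A B : Set X} (hA : MeasurableSet A) (hB : MeasurableSet B) :
    T.projR hA * T.projR hB = T.projR (hA.inter hB) := Subtype.ext (T.projOp_mul hA hB)

theorem projR_compl {A : Set X} (hA : MeasurableSet A) : 1 - T.projR hA = T.projR hA.compl :=
  Subtype.ext (T.projOp_compl hA)

/-- Expresses the order of the measure algebra multiplicatively, in a form every algebra isomorphism
respects. -/
theorem projR_mul_eq_left_iff {A B : Set X} (hA : MeasurableSet A) (hB : MeasurableSet B) :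
    T.projR hA * T.projR hB = T.projR hA ↔ A ≤ᵐ[μ] B := by
  rw [projR_mul]
  refine Subtype.ext_iff.trans ((T.projOp_eq_iff (hA.inter hB) hA).trans ⟨fun h => ?_, fun h => ?_⟩)
  · exact h.symm.le.trans Set.inter_subset_right.eventuallyLE
  · refine Filter.EventuallyLE.antisymm Set.inter_subset_left.eventuallyLE ?_
    filter_upwards [h] with x hx hxA using ⟨hxA, hx hxA⟩

theorem exists_eq_projR {a : T.R} (ha : a ∈ T.C) (haa : a * a = a) :
    ∃ (A : Set X) (hA : MeasurableSet A), a = T.projR hA := by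
  obtain ⟨f, hf⟩ := ha
  have h : T.funOp f * T.funOp f = T.funOp f := by
    rw [hf]; exact congrArg Subtype.val haa
  obtain ⟨A, hA, hfA⟩ := T.exists_eq_projOp h
  exact ⟨A, hA, Subtype.ext (hf.symm.trans hfA)⟩

theorem groupR_mul_projR (g : G) {A : Set X} (hA : MeasurableSet A) :
    T.groupR g * T.projR hA =
      T.projR ((T.measurePreserving (-g)).measurable hA) * T.groupR g :=
  Subtype.ext (T.groupOp_mul_projOp g hA)

end MPAction

/-! ### Transport of sets and transformations along `γ`. -/

section Isomorphism

variable {G₁ G₂ X₁ X₂ : Type*} [AddCommGroup G₁] [AddCommGroup G₂]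
  [MeasurableSpace X₁] [MeasurableSpace X₂] {μ₁ : Measure X₁} {μ₂ : Measure X₂}
  {T₁ : MPAction G₁ μ₁} {T₂ : MPAction G₂ μ₂}

theorem image_symm_eq (γ : T₁.R ≃⋆ₐ[ℂ] T₂.R) {s : Set T₁.R} {t : Set T₂.R} (h : γ '' s = t) :
    γ.symm '' t = s := by
  rw [← h, Set.image_image]
  simp

variable [IsFiniteMeasure μ₁] [IsFiniteMeasure μ₂]

theorem exists_image_projR (γ : T₁.R ≃⋆ₐ[ℂ] T₂.R) (hγC : γ '' T₁.C = T₂.C) {A : Set X₁}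
    (hA : MeasurableSet A) : ∃ (B : Set X₂) (hB : MeasurableSet B),
      γ (T₁.projR hA) = T₂.projR hB := by
  refine T₂.exists_eq_projR (hγC ▸ Set.mem_image_of_mem γ (T₁.projR_mem_C hA)) ?_
  rw [← map_mul, (T₁.projR_mul_eq_left_iff hA hA).2 (Filter.EventuallyLE.refl _ _)]

theorem exists_preimage_projR (γ : T₁.R ≃⋆ₐ[ℂ] T₂.R) (hγC : γ '' T₁.C = T₂.C) {B : Set X₂}
    (hB : MeasurableSet B) : ∃ (A : Set X₁) (hA : MeasurableSet A),
      γ (T₁.projR hA) = T₂.projR hB := by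
  obtain ⟨A, hA, h⟩ := exists_image_projR γ.symm (image_symm_eq γ hγC) hB
  exact ⟨A, hA, by rw [← h, StarAlgEquiv.apply_symm_apply]⟩

/-- The isomorphism of measure algebras given by an isomorphism of crossed products which
preserves the Cartan subalgebras. -/
def measureAlgebraRel (γ : T₁.R ≃⋆ₐ[ℂ] T₂.R) (hγC : γ '' T₁.C = T₂.C) :
    MeasureAlgebraRel μ₁ μ₂ where
  rel A B := ∃ (hA : MeasurableSet A) (hB : MeasurableSet B), γ (T₁.projR hA) = T₂.projR hB
  measurable_left h := h.1
  measurable_right h := h.2.1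
  exists_right A hA := by
    obtain ⟨B, hB, h⟩ := exists_image_projR γ hγC hA
    exact ⟨B, hA, hB, h⟩
  exists_left B hB := by
    obtain ⟨A, hA, h⟩ := exists_preimage_projR γ hγC hB
    exact ⟨A, hA, hB, h⟩
  ae_le_iff := by
    rintro A B A' B' ⟨hA, hB, h⟩ ⟨hA', hB', h'⟩
    rw [← T₁.projR_mul_eq_left_iff hA hA', ← T₂.projR_mul_eq_left_iff hB hB', ← h, ← h',
      ← map_mul, (EquivLike.injective γ).eq_iff]
  compl := by
    rintro A B ⟨hA, hB, h⟩
    exact ⟨hA.compl, hB.compl, by rw [← T₁.projR_compl hA, ← T₂.projR_compl hB, map_sub, map_one, h]⟩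

/-- An isomorphism of crossed products which preserves the distinguished subalgebras intertwines
each transformation of the second action with a transformation of the first one. -/
theorem exists_intertwines [NeZero μ₁] [StandardBorelSpace X₂] (γ : T₁.R ≃⋆ₐ[ℂ] T₂.R)
    (hγS : γ '' T₁.S = T₂.S) (hγC : γ '' T₁.C = T₂.C) {f : X₁ → X₂}
    (hfγ : ∀ (A : Set X₁) (B : Set X₂) (hA : MeasurableSet A) (hB : MeasurableSet B),
      γ (T₁.projR hA) = T₂.projR hB → f ⁻¹' B =ᵐ[μ₁] A) (g : G₂) :
    ∃ h, T₂ g ∘ f =ᵐ[μ₁] f ∘ T₁ h := by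
  classical
  -- Moving `1_B` past `v_k` produces the preimage of `B` under `T₂ (-k)`, so `k = -g` is the
  -- element to use.
  obtain ⟨k, rfl⟩ : ∃ k, g = -k := ⟨-g, (neg_neg g).symm⟩
  obtain ⟨u, huS, hu⟩ : T₂.groupR k ∈ γ '' T₁.S := hγS ▸ T₂.groupR_mem_S k
  have hinv : γ.symm (T₂.groupR (-k)) * u = 1 := by
    apply EquivLike.injective γ
    rw [map_mul, StarAlgEquiv.apply_symm_apply, hu, T₂.groupR_neg_mul, map_one]
  obtain ⟨h, c, hc, hcoef⟩ := T₁.exists_coeff_ne_zero huS hinv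
  -- For each `B`, the partners `A` of `B` and `A'` of `T₂ (-k) ⁻¹' B` satisfy `A = T₁ h ⁻¹' A'`,
  -- and `f` realizes both partnerships as preimages.
  have key : f =ᵐ[μ₁] (T₂ (-k) ∘ f) ∘ T₁ h := by
    refine ae_eq_of_forall_preimage_ae_eq fun B hB => ?_
    have hB' := (T₂.measurePreserving (-k)).measurable hB
    obtain ⟨A, hA, hAB⟩ := exists_preimage_projR γ hγC hB
    obtain ⟨A', hA', hAB'⟩ := exists_preimage_projR γ hγC hB'
    have hcomm : u * T₁.projR hA = T₁.projR hA' * u := by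
      apply EquivLike.injective γ
      rw [map_mul, map_mul, hu, hAB, hAB', T₂.groupR_mul_projR]
    have hAA := T₁.ae_eq_preimage_of_coeff hc hcoef hA hA' (congrArg Subtype.val hcomm)
    refine (hfγ A B hA hB hAB).trans (hAA.trans ?_)
    exact (T₁.quasiMeasurePreserving h).preimage_ae_eq (hfγ A' _ hA' hB' hAB').symm
  -- Composing `key` with `T₁ (-h)` moves `T₁ h` to the other side.
  refine ⟨-h, ?_⟩
  have h1 := (T₁.quasiMeasurePreserving (-h)).ae_eq_comp key
  have h2 := T₁.map_add h (-h)
  rw [add_neg_cancel] at h2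
  filter_upwards [h1, h2, T₁.map_zero] with x hx hx2 hx3
  simp only [Function.comp_apply, id] at *
  rw [hx, ← hx2, hx3]

end Isomorphism

end CrossedProd

end

theorem proposition1p2
    {G₁ G₂ X₁ X₂ : Type*} [AddCommGroup G₁] [Countable G₁] [AddCommGroup G₂] [Countable G₂]
    [MeasurableSpace X₁] [StandardBorelSpace X₁] [MeasurableSpace X₂] [StandardBorelSpace X₂]
    (μ₁ : Measure X₁) [IsProbabilityMeasure μ₁] (μ₂ : Measure X₂) [IsProbabilityMeasure μ₂]
    (T₁ : CrossedProd.MPAction G₁ μ₁) (T₂ : CrossedProd.MPAction G₂ μ₂)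
    (hT₁ : T₁.IsFree) (hT₂ : T₂.IsFree)
    (γ : T₁.R ≃⋆ₐ[ℂ] T₂.R) (hγS : γ '' T₁.S = T₂.S) (hγC : γ '' T₁.C = T₂.C) :
    ∃ (β : G₂ ≃+ G₁) (S : CrossedProd.NonsingularIso μ₁ μ₂),
      (∀ g : G₂, T₂ g =ᵐ[μ₂] S.toFun ∘ T₁ (β g) ∘ S.invFun) ∧
      (T₁.IsErgodic ∨ T₂.IsErgodic → MeasurePreserving S.toFun μ₁ μ₂) := by
  have := nonempty_of_isProbabilityMeasure μ₁
  have := nonempty_of_isProbabilityMeasure μ₂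
  obtain ⟨S, hS, hS'⟩ := (CrossedProd.measureAlgebraRel γ hγC).exists_nonsingularIso
  have H := CrossedProd.exists_intertwines γ hγS hγC
    fun A B hA hB h => hS A B ⟨hA, hB, h⟩
  have H' := CrossedProd.exists_intertwines γ.symm (CrossedProd.image_symm_eq γ hγS)
    (CrossedProd.image_symm_eq γ hγC)
    fun B A hB hA h => hS' A B ⟨hA, hB, by rw [← h, StarAlgEquiv.apply_symm_apply]⟩
  obtain ⟨β, hβ⟩ := CrossedProd.exists_addEquiv_of_intertwines hT₁ hT₂ S H fun h =>
    (H' h).imp fun g hg => S.symm.symm_intertwines hg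
  refine ⟨β, S, fun g => S.eq_conj (hβ g), ?_⟩
  rintro (hE | hE)
  -- With `T₁` ergodic the argument applies to `S⁻¹`; pushing `μ₁ = (S⁻¹)_* μ₂` forward by `S` gives
  -- `μ₂`.
  · have hm := S.symm.measurePreserving_of_isErgodic H' hE
    refine ⟨S.quasiMeasurePreserving.measurable, ?_⟩
    refine (congrArg (Measure.map S.toFun) hm.map_eq.symm).trans ?_
    rw [Measure.map_map S.quasiMeasurePreserving.measurable hm.measurable]
    exact (Measure.map_congr S.right_inv).trans Measure.map_id
  · exact S.measurePreserving_of_isErgodic H hE
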